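/- **Theorem 3.1.** Let $M\ge N\ge 1$ be integers, let $0<q<1$, and let $w(i,j)$, $i,j\ge 1$, be independent random variables with values in $\mathbb{N}=\{0,1,2,\dots\}$ and geometric law $\mathbb{P}[w(i,j)=k]=(1-q)q^k$, $k\in\mathbb{N}$. Let $$G(M,N)=\max_{\pi}\sum_{(i,j)\in\pi}w(i,j),$$ where the maximum is over all up/right paths $\pi$ from $(1,1)$ to $(M,N)$, i.e. sequences $(1,1)=(i_1,j_1),\dots,(i_{M+N-1},j_{M+N-1})=(M,N)$ in which every step increases exactly one coordinate, by $1$. Put $\Delta_N(x)=\prod_{1\le i<j\le N}(x_i-x_j)$ and let $$u_N(x)=\frac1{Z_N}\,\Delta_N(x)^2\prod_{j=1}^N\binom{M-N+x_j}{x_j}q^{x_j},\qquad x=(x_1,\dots,x_N)\in\mathbb{N}^N,$$ where $Z_N$ is the sum over $\mathbb{N}^N$ of $\Delta_N(x)^2\prod_{j=1}^N\binom{M-N+x_j}{x_j}q^{x_j}$. Then $u_N$ is a probability density with respect to counting measure on $\mathbb{N}^N$ (the Meixner ensemble), and, with $x_{\max}=\max_{1\le j\le N}x_j$ the position of its largest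 particle, $G(M,N)+N-1$ has exactly the same law as $x_{\max}$; that is, $$\mathbb{P}[G(M,N)\le t]=\mathbb{P}[x_{\max}\le t+N-1]\qquad\text{for all } t\in\mathbb{N}.$$ -/

import Mathlib

open MeasureTheory ProbabilityTheory

/-- An elementary step of an up/right path: exactly one of the two coordinates grows,
and it grows by one. -/
def UpRightStep (a b : ℕ+ × ℕ+) : Prop :=
  (b.1 = a.1 + 1 ∧ b.2 = a.2) ∨ (b.1 = a.1 ∧ b.2 = a.2 + 1)

/-- An up/right path from `(1,1)` to `(M,N)`, as the list of the `M + N - 1` sites it visits. -/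
structure IsUpRightPath (M N : ℕ+) (π : List (ℕ+ × ℕ+)) : Prop where
  length_eq : π.length = (M : ℕ) + (N : ℕ) - 1
  start_eq : π.head? = some (1, 1)
  end_eq : π.getLast? = some (M, N)
  steps : π.IsChain UpRightStep

/-- The last-passage time `G(M,N)` of the weights `w`: the maximum, over all up/right paths
from `(1,1)` to `(M,N)`, of the total weight collected along the path. The set of these totals is
non-empty and bounded, so the supremum in `ℕ` is a maximum. -/
noncomputable def lastPassageTime (w : ℕ+ × ℕ+ → ℕ) (M N : ℕ+) : ℕ :=
  sSup {s | ∃ π, IsUpRightPath M N π ∧ s = (π.map w).sum}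

/-- The Vandermonde product `Δ_N(x) = ∏_{i < j} (x_i - x_j)`. -/
def vandermondeProd {N : ℕ} (x : Fin N → ℕ) : ℝ :=
  ∏ i : Fin N, ∏ j ∈ Finset.Ioi i, ((x i : ℝ) - (x j : ℝ))

/-- The unnormalized density `Δ_N(x)² ∏_j v(x_j)` on `ℕ^N`. -/
def opeWeight (N : ℕ) (v : ℕ → ℝ) (x : Fin N → ℕ) : ℝ :=
  vandermondeProd x ^ 2 * ∏ j : Fin N, v (x j)

/-- The normalization constant `Z_N`. -/
noncomputable def opePartition (N : ℕ) (v : ℕ → ℝ) : ℝ :=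
  ∑' x : Fin N → ℕ, opeWeight N v x

/-- The orthogonal polynomial ensemble on `ℕ^N` with one-particle weight `v`: the measure with
density `u_N(x) = Z_N⁻¹ Δ_N(x)² ∏_j v(x_j)` with respect to counting measure. -/
noncomputable def opEnsemble (N : ℕ) (v : ℕ → ℝ) : Measure (Fin N → ℕ) :=
  Measure.count.withDensity fun x => ENNReal.ofReal (opeWeight N v x / opePartition N v)

/-- The Meixner weight `binom(M - N + x, x) q^x`, used for `N ≤ M`. -/
def meixnerWeight (M N : ℕ) (q : ℝ) (x : ℕ) : ℝ :=
  ((M - N + x).choose x : ℝ) * q ^ x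

/-- The Meixner ensemble on `ℕ^N`, used for `N ≤ M`. -/
noncomputable def meixnerEnsemble (M N : ℕ) (q : ℝ) : Measure (Fin N → ℕ) :=
  opEnsemble N (meixnerWeight M N q)

/-- The position `x_max = max_j x_j` of the largest particle, used for `N ≥ 1`. -/
def largestParticle {N : ℕ} (x : Fin N → ℕ) : ℕ :=
  Finset.univ.sup x

/-! The proof is the Robinson-Schensted-Knuth correspondence in Fomin's growth-diagram form.
Partitions sit at the lattice corners, zero on the axes, and `growthRule` fills in each cell from
its weight. The first row obeys the recursion G = max of the two previous values + w, so it is the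
last-passage time (`lastPassageTime_eq_growth`).

The local rule is invertible cell by cell. Hence arrays with final partition λ biject with pairs of
interlacing chains from 0 to λ of lengths M and N, read along the two outer sides (`bijOn_growth`).
The weights add up to |λ| (`sum_growth`), so for geometric weights all these arrays are equally
likely, and λ has probability (1-q)^(MN) q^|λ| times the number of pairs (`measure_growth_eq`).

Each chain count is a Vandermonde product in the shifted rows, up to a constant
(`card_gtChains_mul_prod_factorial`). For the chain of length M, the M-N empty rows contribute the
binomials of the Meixner weight (`exists_vandermondeProd_add_eq`). The shifted rows of λ thus have
the law of the ordered Meixner ensemble, and the first of them is G + N - 1. Comparison on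
permutation-invariant sets (`opEnsemble_eq_of_strictAnti`) gives both normalization and the law of
the maximum; Z_N is never computed. -/

/-! ### The local rule and its inverse -/

/-- Interlacing `a ≺ b` of sequences: `b / a` is a horizontal strip. -/
def Interlace (a b : ℕ → ℕ) : Prop := ∀ i, b (i + 1) ≤ a i ∧ a i ≤ b i

/-- The local rule of the growth diagrams for the Robinson-Schensted-Knuth correspondence:
it computes the partition at the upper right corner of a cell with weight `k` from those
at the other three corners, `a` being opposite to the new one. -/
def growthRule (k : ℕ) (a b c : ℕ → ℕ) : ℕ → ℕ
  | 0 => max (b 0) (c 0) + k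
  | i + 1 => max (b (i + 1)) (c (i + 1)) + min (b i) (c i) - a i

/-- The inverse local rule, recovering the lower left corner of a cell. -/
def growthRuleInv (b c d : ℕ → ℕ) : ℕ → ℕ := fun i =>
  max (b (i + 1)) (c (i + 1)) + min (b i) (c i) - d (i + 1)

/-- The weight of a cell, recovered from its corners. -/
def growthRuleWeight (b c d : ℕ → ℕ) : ℕ := d 0 - max (b 0) (c 0)

theorem Interlace.eq_zero {a b : ℕ → ℕ} (h : Interlace a b) (hb : b = 0) : a = 0 := by
  subst hb
  funext i
  exact Nat.le_zero.1 (h i).2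

theorem interlace_zero : Interlace 0 0 := fun _ => ⟨le_rfl, le_rfl⟩

theorem Interlace.zero_left {b : ℕ → ℕ} (h : ∀ i, b (i + 1) = 0) : Interlace 0 b :=
  fun i => ⟨(h i).le, Nat.zero_le _⟩

section Rule

variable {a b c d : ℕ → ℕ}

theorem interlace_growthRule_left (k : ℕ) (hb : Interlace a b) (hc : Interlace a c) :
    Interlace b (growthRule k a b c) := by
  intro i
  have h1 := hb i
  have h2 := hc i
  refine ⟨by simp only [growthRule]; omega, ?_⟩
  cases i with
  | zero => simp only [growthRule]; omega
  | succ i =>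
    have h3 := hb i
    have h4 := hc i
    simp only [growthRule]; omega

theorem growthRule_comm (k : ℕ) : growthRule k a b c = growthRule k a c b := by
  funext i
  cases i <;> simp only [growthRule, max_comm, min_comm]

theorem interlace_growthRule_right (k : ℕ) (hb : Interlace a b) (hc : Interlace a c) :
    Interlace c (growthRule k a b c) :=
  growthRule_comm (b := b) k ▸ interlace_growthRule_left k hc hb

theorem interlace_growthRuleInv_left (hb : Interlace b d) (hc : Interlace c d) :
    Interlace (growthRuleInv b c d) b := by
  intro i
  have h1 := hb i
  have h2 := hc i
  have h3 := hb (i + 1)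
  have h4 := hc (i + 1)
  simp only [growthRuleInv]; omega

theorem growthRuleInv_comm : growthRuleInv b c d = growthRuleInv c b d := by
  funext i
  simp only [growthRuleInv, max_comm, min_comm]

theorem interlace_growthRuleInv_right (hb : Interlace b d) (hc : Interlace c d) :
    Interlace (growthRuleInv b c d) c :=
  growthRuleInv_comm (b := b) ▸ interlace_growthRuleInv_left hc hb

theorem growthRule_growthRuleInv (hb : Interlace b d) (hc : Interlace c d) :
    growthRule (growthRuleWeight b c d) (growthRuleInv b c d) b c = d := by
  funext i
  cases i with
  | zero =>
    have h1 := hb 0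
    have h2 := hc 0
    simp only [growthRule, growthRuleWeight]; omega
  | succ i =>
    have h1 := hb i
    have h2 := hc i
    have h3 := hb (i + 1)
    have h4 := hc (i + 1)
    simp only [growthRule, growthRuleInv]; omega

/-- The rule for row `i + 1` is linear in `a i` and can be solved for it. Interlacing gives `a i ≤
min (b i) (c i)`, so the natural subtraction does not truncate. -/
theorem growthRuleInv_growthRule (k : ℕ) (hb : Interlace a b) (hc : Interlace a c) :
    growthRuleInv b c (growthRule k a b c) = a := by
  funext i
  have h1 := hb i
  have h2 := hc i
  simp only [growthRule, growthRuleInv]; omega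

theorem growthRuleWeight_growthRule (k : ℕ) :
    growthRuleWeight b c (growthRule k a b c) = k := by
  simp only [growthRule, growthRuleWeight]; omega

/-- Since max + min is the sum, the rows telescope: the minimum in row `i` is passed on to row `i +
1`. The hypothesis `hK` says that nothing is left to pass on after row `K`. -/
theorem sum_growthRule (k K : ℕ) (hb : Interlace a b) (hc : Interlace a c)
    (hK : min (b K) (c K) = 0) :
    ∑ i ∈ Finset.range (K + 1), growthRule k a b c i + ∑ i ∈ Finset.range (K + 1), a i =
      ∑ i ∈ Finset.range (K + 1), b i + ∑ i ∈ Finset.range (K + 1), c i + k := by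
  have key : ∀ n, ∑ i ∈ Finset.range (n + 1), growthRule k a b c i +
      ∑ i ∈ Finset.range n, a i + min (b n) (c n) =
      ∑ i ∈ Finset.range (n + 1), b i + ∑ i ∈ Finset.range (n + 1), c i + k := by
    intro n
    induction n with
    | zero => simp [growthRule]; omega
    | succ n ih =>
      rw [Finset.sum_range_succ _ (n + 1), Finset.sum_range_succ a n,
        Finset.sum_range_succ b (n + 1), Finset.sum_range_succ c (n + 1)]
      have h1 := hb n
      have h2 := hc n
      simp only [growthRule] at ih ⊢; omega
  have h := key K
  have h1 := hb K
  have h2 := hc K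
  rw [Finset.sum_range_succ a K]
  omega

end Rule

/-! ### Growth diagrams -/

/-- The growth diagram of a matrix of weights, with zero boundary values. -/
def growth (W : ℕ → ℕ → ℕ) : ℕ → ℕ → ℕ → ℕ
  | 0, _ => 0
  | _ + 1, 0 => 0
  | i + 1, j + 1 =>
    growthRule (W i j) (growth W i j) (growth W i (j + 1)) (growth W (i + 1) j)
termination_by i j => (i, j)

section Growth

variable (W : ℕ → ℕ → ℕ)

@[simp] theorem growth_zero_left (j : ℕ) : growth W 0 j = 0 := by
  rw [growth]

@[simp] theorem growth_zero_right (i : ℕ) : growth W i 0 = 0 := by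
  cases i <;> rw [growth]

theorem growth_succ_succ (i j : ℕ) : growth W (i + 1) (j + 1) =
    growthRule (W i j) (growth W i j) (growth W i (j + 1)) (growth W (i + 1) j) := by
  rw [growth]

/-- A cell can create row `l + 1` only if both neighbours already have row `l`, so there are at most
min(i, j) rows. -/
theorem growth_eq_zero_of_le (i j l : ℕ) (h : i ≤ l ∨ j ≤ l) : growth W i j l = 0 := by
  induction i generalizing j l with
  | zero => simp
  | succ i ihi =>
    induction j generalizing l with
    | zero => simp
    | succ j ihj =>
      cases l with
      | zero => omega
      | succ l =>
        rw [growth_succ_succ]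
        have h1 := ihi (j + 1) (l + 1) (by omega)
        have h2 := ihj (l + 1) (by omega)
        have h3 : min (growth W i (j + 1) l) (growth W (i + 1) j l) = 0 := by
          rcases h with h | h
          · simp [ihi (j + 1) l (by omega)]
          · simp [ihj l (by omega)]
        simp only [growthRule]
        omega

/-- The local rule propagates interlacing from the two edges at the lower left of a cell to the two
opposite ones, so both directions must be proved together. -/
theorem interlace_growth (i j : ℕ) :
    Interlace (growth W i j) (growth W (i + 1) j) ∧
      Interlace (growth W i j) (growth W i (j + 1)) := by
  induction i generalizing j with
  | zero =>
    refine ⟨?_, by simpa using interlace_zero⟩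
    rw [growth_zero_left]
    exact .zero_left fun i => growth_eq_zero_of_le _ _ _ _ (by omega)
  | succ i ihi =>
    have hright : ∀ j, Interlace (growth W (i + 1) j) (growth W (i + 1) (j + 1)) := by
      intro j
      induction j with
      | zero =>
        rw [growth_zero_right]
        exact .zero_left fun i => growth_eq_zero_of_le _ _ _ _ (by omega)
      | succ j ihj =>
        rw [growth_succ_succ W i (j + 1)]
        exact interlace_growthRule_right _ (ihi _).2 (ihi _).1
    refine ⟨?_, hright j⟩
    cases j with
    | zero => simpa using interlace_zero
    | succ j =>
      rw [growth_succ_succ W (i + 1) j]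
      exact interlace_growthRule_left _ (hright _) (by
        induction j with
        | zero => simpa using interlace_zero
        | succ j ihj =>
          rw [growth_succ_succ W (i + 1) j]
          exact interlace_growthRule_left _ (hright _) ihj)

theorem growth_eq_growthRuleInv (i j : ℕ) : growth W i j =
    growthRuleInv (growth W i (j + 1)) (growth W (i + 1) j) (growth W (i + 1) (j + 1)) := by
  rw [growth_succ_succ, growthRuleInv_growthRule _ (interlace_growth W i j).2
    (interlace_growth W i j).1]

theorem growthRuleWeight_growth (i j : ℕ) :
    growthRuleWeight (growth W i (j + 1)) (growth W (i + 1) j) (growth W (i + 1) (j + 1)) =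
      W i j := by
  rw [growth_succ_succ, growthRuleWeight_growthRule]

theorem sum_growth (m n K : ℕ) (hn : n ≤ K) :
    ∑ l ∈ Finset.range K, growth W m n l =
      ∑ i ∈ Finset.range m, ∑ j ∈ Finset.range n, W i j := by
  induction m generalizing n with
  | zero => simp
  | succ m ihm =>
    induction n with
    | zero => simp
    | succ n ihn =>
      obtain ⟨K, rfl⟩ : ∃ K', K = K' + 1 := ⟨K - 1, by omega⟩
      have h := sum_growthRule (W m n) K (interlace_growth W m n).2 (interlace_growth W m n).1
        (by rw [growth_eq_zero_of_le W (m + 1) n K (by omega)]; simp)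
      rw [← growth_succ_succ, ihm n (by omega), ihm (n + 1) hn, ihn (by omega)] at h
      rw [Finset.sum_range_succ (fun i => ∑ j ∈ Finset.range n, W i j)] at h
      rw [Finset.sum_range_succ (fun i => ∑ j ∈ Finset.range (n + 1), W i j),
        Finset.sum_range_succ (fun j => W m j)]
      omega

theorem growth_congr {W W' : ℕ → ℕ → ℕ} {m n : ℕ}
    (h : ∀ i < m, ∀ j < n, W i j = W' i j) :
    ∀ i ≤ m, ∀ j ≤ n, growth W i j = growth W' i j := by
  intro i hi
  induction i with
  | zero => simp
  | succ i ihi =>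
    intro j hj
    induction j with
    | zero => simp
    | succ j ihj =>
      rw [growth_succ_succ, growth_succ_succ, ihi (by omega) j (by omega),
        ihi (by omega) (j + 1) hj, ihj (by omega), h i (by omega) j (by omega)]

/-- The weights are determined by the partitions on the last row and column. -/
theorem growth_injective {W W' : ℕ → ℕ → ℕ} {m n : ℕ}
    (hrow : ∀ j ≤ n, growth W m j = growth W' m j)
    (hcol : ∀ i ≤ m, growth W i n = growth W' i n) :
    ∀ i < m, ∀ j < n, W i j = W' i j := by
  -- The diagram is recovered backwards; `a` and `b` are distances to the upper right corner.
  have key : ∀ a ≤ m, ∀ b ≤ n, growth W (m - a) (n - b) = growth W' (m - a) (n - b) := by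
    intro a
    induction a with
    | zero => exact fun _ b hb => hrow _ (by omega)
    | succ a iha =>
      intro ha b hb
      induction b with
      | zero => exact hcol _ (by omega)
      | succ b ihb =>
        rw [growth_eq_growthRuleInv, growth_eq_growthRuleInv W',
          show m - (a + 1) + 1 = m - a by omega, show n - (b + 1) + 1 = n - b by omega,
          iha (by omega) b (by omega), ihb (by omega)]
        have := iha (by omega) (b + 1) hb
        rw [this]
  have key' : ∀ i ≤ m, ∀ j ≤ n, growth W i j = growth W' i j := by
    intro i hi j hj
    have := key (m - i) (by omega) (n - j) (by omega)
    rwa [show m - (m - i) = i by omega, show n - (n - j) = j by omega] at this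
  intro i hi j hj
  rw [← growthRuleWeight_growth W i j, ← growthRuleWeight_growth W' i j,
    key' i hi.le (j + 1) hj, key' (i + 1) hi j hj.le, key' (i + 1) hi (j + 1) hj]

end Growth

/-! ### Reconstruction from the outer sides -/

/-- The growth diagram reconstructed from the chains `p` on its last column and `r` on its last
row; the indices are distances to the upper right corner. -/
def growthBackward (p r : ℕ → ℕ → ℕ) (m n : ℕ) : ℕ → ℕ → ℕ → ℕ
  | 0, j => r (n - j)
  | i + 1, 0 => p (m - (i + 1))
  | i + 1, j + 1 => growthRuleInv (growthBackward p r m n i (j + 1))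
      (growthBackward p r m n (i + 1) j) (growthBackward p r m n i j)
termination_by i j => (i, j)

section Backward

variable {p r : ℕ → ℕ → ℕ} {m n : ℕ}

theorem growthBackward_zero_left (j : ℕ) : growthBackward p r m n 0 j = r (n - j) := by
  rw [growthBackward]

theorem growthBackward_zero_right (hpr : p m = r n) (i : ℕ) :
    growthBackward p r m n i 0 = p (m - i) := by
  cases i <;> rw [growthBackward]
  simp [hpr]

theorem growthBackward_succ_succ (i j : ℕ) : growthBackward p r m n (i + 1) (j + 1) =
    growthRuleInv (growthBackward p r m n i (j + 1))
      (growthBackward p r m n (i + 1) j) (growthBackward p r m n i j) := by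
  rw [growthBackward]

theorem interlace_growthBackward (hpr : p m = r n)
    (hp : ∀ i < m, Interlace (p i) (p (i + 1))) (hr : ∀ j < n, Interlace (r j) (r (j + 1))) :
    (∀ i ≤ m, ∀ j < n,
      Interlace (growthBackward p r m n i (j + 1)) (growthBackward p r m n i j)) ∧
    ∀ i < m, ∀ j ≤ n,
      Interlace (growthBackward p r m n (i + 1) j) (growthBackward p r m n i j) := by
  have step : ∀ i < m, (∀ j < n,
      Interlace (growthBackward p r m n i (j + 1)) (growthBackward p r m n i j)) → ∀ j ≤ n,
      Interlace (growthBackward p r m n (i + 1) j) (growthBackward p r m n i j) := by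
    intro i hi h j hj
    induction j with
    | zero =>
      rw [growthBackward_zero_right hpr, growthBackward_zero_right hpr]
      have := hp (m - (i + 1)) (by omega)
      rwa [show m - (i + 1) + 1 = m - i by omega] at this
    | succ j ih =>
      rw [growthBackward_succ_succ]
      exact interlace_growthRuleInv_left (h j (by omega)) (ih (by omega))
  have hor : ∀ i ≤ m, ∀ j < n,
      Interlace (growthBackward p r m n i (j + 1)) (growthBackward p r m n i j) := by
    intro i
    induction i with
    | zero =>
      intro _ j hj
      rw [growthBackward_zero_left, growthBackward_zero_left]
      have := hr (n - (j + 1)) (by omega)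
      rwa [show n - (j + 1) + 1 = n - j by omega] at this
    | succ i ih =>
      intro hi j hj
      rw [growthBackward_succ_succ]
      exact interlace_growthRuleInv_right (ih (by omega) j hj)
        (step i (by omega) (ih (by omega)) j hj.le)
  exact ⟨hor, fun i hi => step i hi (hor i hi.le)⟩

/-- Every pair of chains with a common end comes from a growth diagram. -/
theorem growth_surjective (hpr : p m = r n) (hp0 : p 0 = 0) (hr0 : r 0 = 0)
    (hp : ∀ i < m, Interlace (p i) (p (i + 1))) (hr : ∀ j < n, Interlace (r j) (r (j + 1))) :
    ∃ W : ℕ → ℕ → ℕ, (∀ i ≤ m, growth W i n = p i) ∧ ∀ j ≤ n, growth W m j = r j := by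
  obtain ⟨hor, ver⟩ := interlace_growthBackward hpr hp hr
  set B := growthBackward p r m n with hB
  -- Only 0 interlaces below 0, so the reconstructed diagram has the zero boundary values required
  -- of a growth diagram.
  have hbot : ∀ j ≤ n, B m j = 0 := by
    intro j
    induction j with
    | zero => intro _; rw [hB, growthBackward_zero_right hpr, Nat.sub_self, hp0]
    | succ j ih => exact fun hj => (hor m le_rfl j hj).eq_zero (ih (by omega))
  have hleft : ∀ i ≤ m, B i n = 0 := by
    intro i
    induction i with
    | zero => intro _; rw [hB, growthBackward_zero_left, Nat.sub_self, hr0]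
    | succ i ih => exact fun hi => (ver i hi n le_rfl).eq_zero (ih (by omega))
  let W : ℕ → ℕ → ℕ := fun i j => growthRuleWeight (B (m - i) (n - (j + 1)))
    (B (m - (i + 1)) (n - j)) (B (m - (i + 1)) (n - (j + 1)))
  have key : ∀ i ≤ m, ∀ j ≤ n, growth W i j = B (m - i) (n - j) := by
    intro i
    induction i with
    | zero => intro _ j hj; rw [growth_zero_left, Nat.sub_zero, hbot _ (by omega)]
    | succ i ihi =>
      intro hi j hj
      induction j with
      | zero => rw [growth_zero_right, Nat.sub_zero, hleft _ (by omega)]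
      | succ j ihj =>
        rw [growth_succ_succ, ihi (by omega) j (by omega), ihi (by omega) (j + 1) hj,
          ihj (by omega)]
        have h1 := ver (m - (i + 1)) (by omega) (n - (j + 1)) (by omega)
        have h2 := hor (m - (i + 1)) (by omega) (n - (j + 1)) (by omega)
        have h3 := growthBackward_succ_succ (p := p) (r := r) (m := m) (n := n)
          (m - (i + 1)) (n - (j + 1))
        rw [← hB] at h3
        rw [show m - (i + 1) + 1 = m - i by omega] at h1 h3
        rw [show n - (j + 1) + 1 = n - j by omega] at h2 h3
        rw [h3, growthRuleInv_comm]
        have h4 := growthRule_growthRuleInv h1 h2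
        rw [growthRuleInv_comm] at h4 ⊢
        exact h4
  refine ⟨W, fun i hi => ?_, fun j hj => ?_⟩
  · rw [key i hi n le_rfl, Nat.sub_self, hB, growthBackward_zero_right hpr]
    congr 1; omega
  · rw [key m le_rfl j hj, Nat.sub_self, hB, growthBackward_zero_left]
    congr 1; omega

end Backward

/-! ### Counting Gelfand-Tsetlin patterns -/

/-- Extension of a tuple by zero. -/
def zeroExtend {n : ℕ} (x : Fin n → ℕ) : ℕ → ℕ := fun i => if h : i < n then x ⟨i, h⟩ else 0

theorem zeroExtend_of_le {n : ℕ} (x : Fin n → ℕ) {i : ℕ} (h : n ≤ i) : zeroExtend x i = 0 :=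
  dif_neg h.not_gt

@[simp] theorem zeroExtend_val {n : ℕ} (x : Fin n → ℕ) (i : Fin n) : zeroExtend x i = x i := by
  simp [zeroExtend]

theorem zeroExtend_injective {n : ℕ} : Function.Injective (zeroExtend (n := n)) := by
  intro x y h
  funext i
  simpa using congrFun h i

open scoped Classical in
/-- The chains `0 ≺ c 1 ≺ ... ≺ c n = a` of interlacing partitions
(Gelfand-Tsetlin patterns with top row `a`), extended to be constant after time `n`. -/
noncomputable def gtChains : ℕ → (ℕ → ℕ) → Finset (ℕ → ℕ → ℕ)
  | 0, a => {fun _ => a}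
  | n + 1, a => (Fintype.piFinset fun i : Fin n => Finset.Icc (a (i + 1)) (a i)).biUnion fun x =>
      (gtChains n (zeroExtend x)).image fun c i => if i ≤ n then c i else a

theorem chain_eq_zero {c : ℕ → ℕ → ℕ} {n : ℕ} (h0 : c 0 = 0)
    (hc : ∀ i < n, Interlace (c i) (c (i + 1))) : ∀ i ≤ n, ∀ l, i ≤ l → c i l = 0 := by
  intro i
  induction i with
  | zero => simp [h0]
  | succ i ih =>
    intro hi l hl
    obtain ⟨l, rfl⟩ : ∃ l', l = l' + 1 := ⟨l - 1, by omega⟩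
    have h1 := (hc i hi l).1
    have h2 := ih (by omega) l (by omega)
    omega

/-- Freezing a chain after time `n` makes it a unique function on ℕ, so that counting functions
counts chains. -/
theorem mem_gtChains {n : ℕ} {a : ℕ → ℕ} (ha : ∀ i, n ≤ i → a i = 0) {c : ℕ → ℕ → ℕ} :
    c ∈ gtChains n a ↔
      c 0 = 0 ∧ (∀ i < n, Interlace (c i) (c (i + 1))) ∧ ∀ i, n ≤ i → c i = a := by
  induction n generalizing a c with
  | zero =>
    have ha' : a = 0 := funext fun i => ha i (Nat.zero_le i)
    subst ha'
    simp only [gtChains, Finset.mem_singleton]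
    constructor
    · rintro rfl
      simp
    · rintro ⟨_, _, h⟩
      funext i
      exact h i (Nat.zero_le i)
  | succ n ih =>
    simp only [gtChains, Finset.mem_biUnion, Finset.mem_image, Fintype.mem_piFinset,
      Finset.mem_Icc]
    constructor
    · rintro ⟨x, hx, c, hc, rfl⟩
      obtain ⟨h0, h1, h2⟩ := (ih fun i hi => zeroExtend_of_le x hi).1 hc
      refine ⟨by simp [h0], fun i hi => ?_, fun i hi => if_neg (by omega)⟩
      rcases (Nat.lt_succ_iff.1 hi).lt_or_eq with h | rfl
      · simpa [h.le, Nat.succ_le_of_lt h] using h1 i h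
      · simp only [le_refl, if_true, h2 i le_rfl]
        rw [if_neg (by omega)]
        intro l
        rcases lt_or_ge l i with hl | hl
        · have := hx ⟨l, hl⟩
          simpa [zeroExtend, hl] using this
        · change _ ≤ zeroExtend x l ∧ zeroExtend x l ≤ _
          rw [zeroExtend_of_le x hl]
          exact ⟨(ha _ (by omega)).le, Nat.zero_le _⟩
    · rintro ⟨h0, h1, h2⟩
      have hz := chain_eq_zero h0 h1 n (by omega)
      have hn := h1 n (by omega)
      rw [h2 (n + 1) le_rfl] at hn
      have hx : zeroExtend (fun i : Fin n => c n i) = c n := by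
        funext l
        by_cases hl : l < n
        · simp [zeroExtend, hl]
        · rw [zeroExtend_of_le _ (not_lt.1 hl), hz l (not_lt.1 hl)]
      refine ⟨fun i => c n i, fun i => hn i, fun i => c (min i n), ?_, ?_⟩
      · rw [ih fun i hi => zeroExtend_of_le _ hi, hx]
        refine ⟨by simp [h0], fun i hi => ?_, fun i hi => by simp [hi]⟩
        simpa [hi.le, Nat.succ_le_of_lt hi] using h1 i (by omega)
      · funext i
        split_ifs with hi
        · simp [hi]
        · rw [h2 i (by omega)]

/-- Branching: a chain is its top row together with a chain ending in the row below. The pieces are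
disjoint because the value at time `n` recovers that row. -/
theorem card_gtChains_succ (n : ℕ) (a : ℕ → ℕ) : (gtChains (n + 1) a).card =
    ∑ x ∈ Fintype.piFinset fun i : Fin n => Finset.Icc (a (i + 1)) (a i),
      (gtChains n (zeroExtend x)).card := by
  classical
  have hend : ∀ (x : Fin n → ℕ) c, c ∈ gtChains n (zeroExtend x) →
      ∀ i, n ≤ i → c i = zeroExtend x :=
    fun x c hc => ((mem_gtChains fun i hi => zeroExtend_of_le x hi).1 hc).2.2
  rw [gtChains, Finset.card_biUnion]
  · refine Finset.sum_congr rfl fun x _ => ?_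
    convert Finset.card_image_of_injOn ?_
    intro c hc c' hc' h
    funext i
    by_cases hi : i ≤ n
    · simpa [hi] using congrFun h i
    · rw [hend x c hc i (by omega), hend x c' hc' i (by omega)]
  · intro x _ y _ hxy
    rw [Function.onFun, Finset.disjoint_left]
    intro f hf hf'
    obtain ⟨c, hc, rfl⟩ := Finset.mem_image.1 hf
    obtain ⟨c', hc', h⟩ := Finset.mem_image.1 hf'
    have := congrFun h n
    simp only [le_refl, if_true, hend x c hc n le_rfl, hend y c' hc' n le_rfl] at this
    exact hxy (zeroExtend_injective this.symm)

theorem sum_Icc_choose_add (a b k j : ℕ) (hab : a ≤ b) :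
    ∑ x ∈ Finset.Icc a b, ((x + k).choose j : ℤ) =
      ((b + k + 1).choose (j + 1) : ℤ) - ((a + k).choose (j + 1) : ℤ) := by
  induction b, hab using Nat.le_induction with
  | base => simp [Nat.choose_succ_succ]
  | succ b hab ih =>
    rw [← Finset.insert_Icc_right_eq_Icc_add_one (by omega), Finset.sum_insert (by simp), ih,
      Nat.choose_succ_succ (b + 1 + k) j, show b + 1 + k = b + k + 1 by omega]
    push_cast
    ring

/-- The number of Gelfand-Tsetlin patterns with a given top row, as a determinant. -/
theorem card_gtChains_eq_det (n : ℕ) (a : ℕ → ℕ) (ha : ∀ i, i + 1 < n → a (i + 1) ≤ a i) :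
    ((gtChains n a).card : ℤ) = (∏ k ∈ Finset.range n, (-1) ^ k) *
      (Matrix.of fun i j : Fin n => ((a i + (n - 1 - i)).choose j : ℤ)).det := by
  induction n generalizing a with
  | zero => simp [gtChains]
  | succ n ih =>
    rw [card_gtChains_succ, Nat.cast_sum]
    set y : Fin (n + 1) → ℕ := fun i => a i + (n + 1 - 1 - i) with hy
    -- Subtracting from each row its predecessor turns the first column, all ones, into (1, 0, ...,
    -- 0); the determinant is then expanded along it.
    have hdet : (Matrix.of fun i j : Fin (n + 1) => ((y i).choose j : ℤ)).det =
        (Matrix.of fun i j : Fin n =>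
          ((y i.succ).choose (j + 1) : ℤ) - ((y i.castSucc).choose (j + 1) : ℤ)).det := by
      rw [Matrix.det_eq_of_forall_row_eq_smul_add_pred
        (B := Matrix.of (Fin.cons (fun j => ((y 0).choose j : ℤ)) fun i j =>
          ((y i.succ).choose j : ℤ) - ((y i.castSucc).choose j : ℤ))) (fun _ => 1)
        (fun j => by simp) (fun i j => by simp), Matrix.det_succ_column_zero,
        Fin.sum_univ_succ]
      simp [Matrix.submatrix, Fin.succAbove]
    -- The hockey-stick identity makes each entry a sum over the interlacing range. The shifted rows
    -- decrease, whence the sign.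
    have hsum : (Matrix.of fun i j : Fin n =>
          ((y i.succ).choose (j + 1) : ℤ) - ((y i.castSucc).choose (j + 1) : ℤ)) =
        -(Matrix.of fun i j : Fin n => ∑ x ∈ Finset.Icc (a (i + 1)) (a i),
          ((x + (n - 1 - i)).choose j : ℤ)) := by
      ext i j
      have hi := i.2
      simp only [Matrix.of_apply, Matrix.neg_apply]
      rw [sum_Icc_choose_add _ _ _ _ (ha i (by omega)), neg_sub]
      simp only [hy, Fin.val_succ, Fin.val_castSucc]
      congr 3
      · congr 1; omega
      · omega
    -- Multilinearity in the rows moves the sums outside the determinant, matching the branching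
    -- rule.
    have hmul : (Matrix.of fun i j : Fin n => ∑ x ∈ Finset.Icc (a (i + 1)) (a i),
          ((x + (n - 1 - i)).choose j : ℤ)).det =
        ∑ x ∈ Fintype.piFinset fun i : Fin n => Finset.Icc (a (i + 1)) (a i),
          (Matrix.of fun i j : Fin n => ((x i + (n - 1 - i)).choose j : ℤ)).det := by
      have := (Matrix.detRowAlternating (R := ℤ) (n := Fin n)).toMultilinearMap.map_sum_finset
        (fun (i : Fin n) x (j : Fin n) => ((x + (n - 1 - i)).choose j : ℤ))
        (fun i => Finset.Icc (a (i + 1)) (a i))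
      refine Eq.trans ?_ this
      congr 1
      ext i j
      simp
    rw [hdet, hsum, Matrix.det_neg, hmul, Fintype.card_fin, ← mul_assoc, Finset.prod_range_succ,
      mul_assoc (∏ k ∈ Finset.range n, (-1 : ℤ) ^ k), ← mul_pow, neg_one_mul, neg_neg, one_pow,
      mul_one, Finset.mul_sum]
    refine Finset.sum_congr rfl fun x hx => ?_
    simp only [Fintype.mem_piFinset, Finset.mem_Icc] at hx
    rw [ih]
    · simp
    · intro i hi
      have h1 := hx ⟨i, by omega⟩
      have h2 := hx ⟨i + 1, hi⟩
      simp only [zeroExtend, hi, dif_pos, show i < n by omega]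
      simp only at h1 h2
      omega

/-! ### Vandermonde products and the dimension formula -/

theorem vandermondeProd_eq_det (n : ℕ) (x : Fin n → ℕ) : vandermondeProd x =
    (∏ k ∈ Finset.range n, (-1) ^ k) * (Matrix.vandermonde fun i => (x i : ℝ)).det := by
  have hsgn : ∏ k ∈ Finset.range n, (-1 : ℝ) ^ k =
      ∏ i : Fin n, ∏ _j ∈ Finset.Ioi i, (-1 : ℝ) := by
    simp only [Finset.prod_const, Fin.card_Ioi]
    rw [← Finset.prod_range_reflect, Finset.prod_range]
  rw [Matrix.det_vandermonde, hsgn, vandermondeProd, ← Finset.prod_mul_distrib]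
  refine Finset.prod_congr rfl fun i _ => ?_
  rw [← Finset.prod_mul_distrib]
  exact Finset.prod_congr rfl fun j _ => by ring

/-- The polynomial j! binom(x, j) is the falling factorial, monic of degree j, so replacing powers
by it leaves the determinant unchanged. -/
theorem det_vandermonde_eq_prod_factorial_mul (n : ℕ) (x : Fin n → ℕ) :
    (Matrix.vandermonde fun i => (x i : ℤ)).det =
      (∏ i : Fin n, ((i : ℕ).factorial : ℤ)) *
        (Matrix.of fun i j : Fin n => ((x i).choose j : ℤ)).det := by
  rw [Matrix.det_eval_matrixOfPolynomials_eq_det_vandermonde (fun i => (x i : ℤ))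
    (fun i => descPochhammer ℤ i) (fun i => descPochhammer_natDegree ℤ i)
    (fun i => monic_descPochhammer ℤ i), ← Matrix.det_mul_row]
  congr 1
  ext i j
  rw [Matrix.of_apply, Matrix.of_apply, descPochhammer_eval_eq_descFactorial,
    Nat.descFactorial_eq_factorial_mul_choose]
  simp

/-- The number of Gelfand-Tsetlin patterns with a given top row, by the Weyl dimension formula. -/
theorem card_gtChains_mul_prod_factorial (n : ℕ) (a : ℕ → ℕ)
    (ha : ∀ i, i + 1 < n → a (i + 1) ≤ a i) :
    ((gtChains n a).card : ℝ) * ∏ i : Fin n, ((i : ℕ).factorial : ℝ) =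
      vandermondeProd fun i : Fin n => a i + (n - 1 - i) := by
  have h1 := congrArg (Int.cast : ℤ → ℝ) (card_gtChains_eq_det n a ha)
  have h2 := congrArg (Int.cast : ℤ → ℝ)
    (det_vandermonde_eq_prod_factorial_mul n fun i => a i + (n - 1 - i))
  have h3 : (((Matrix.vandermonde fun i : Fin n => ((a i + (n - 1 - i) : ℕ) : ℤ)).det : ℤ) : ℝ) =
      (Matrix.vandermonde fun i : Fin n => ((a i + (n - 1 - i) : ℕ) : ℝ)).det := by
    rw [Matrix.det_vandermonde, Matrix.det_vandermonde]
    push_cast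
    rfl
  rw [h3] at h2
  rw [vandermondeProd_eq_det, h2]
  push_cast at h1 ⊢
  rw [h1]
  ring

theorem vandermondeProd_add_const {n : ℕ} (x : Fin n → ℕ) (k : ℕ) :
    vandermondeProd (fun i => x i + k) = vandermondeProd x := by
  simp [vandermondeProd]

theorem vandermondeProd_castSucc {n : ℕ} (x : Fin (n + 1) → ℕ) :
    vandermondeProd x = vandermondeProd (fun i => x (Fin.castSucc i)) *
      ∏ i : Fin n, ((x (Fin.castSucc i) : ℝ) - x (Fin.last n)) := by
  have key : ∀ (m : ℕ) (y : Fin m → ℕ), vandermondeProd y =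
      ∏ i, ∏ j, if i < j then ((y i : ℝ) - y j) else 1 := by
    intro m y
    refine Finset.prod_congr rfl fun i _ => ?_
    rw [← Finset.prod_filter]
    congr 1
    ext j
    simp
  rw [key, key, Fin.prod_univ_castSucc]
  simp only [Fin.prod_univ_castSucc (fun j => ite (_ < j) _ _), Finset.prod_mul_distrib]
  simp [(Fin.le_last _).not_gt]

theorem choose_succ_add_mul (k x : ℕ) :
    ((k + 1 + x).choose x : ℝ) * (k + 1) = (k + x).choose x * (x + k + 1) := by
  have h := Nat.add_one_mul_choose_eq (k + x) k
  rw [Nat.choose_symm_add, show k + x + 1 = k + 1 + x by omega, Nat.choose_symm_add] at h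
  have h' := congrArg (Nat.cast : ℕ → ℝ) h
  push_cast at h'
  linarith

/-- Adding `k` empty rows to a partition with `N` rows changes the Vandermonde product by
binomial factors. -/
theorem exists_vandermondeProd_add_eq (N k : ℕ) : ∃ K : ℝ, 0 < K ∧ ∀ a : ℕ → ℕ,
    (∀ i, N ≤ i → a i = 0) →
    vandermondeProd (fun i : Fin (N + k) => a i + (N + k - 1 - i)) =
      K * (vandermondeProd (fun i : Fin N => a i + (N - 1 - i)) *
        ∏ i : Fin N, ((k + (a i + (N - 1 - i))).choose (a i + (N - 1 - i)) : ℝ)) := by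
  induction k with
  | zero => exact ⟨1, one_pos, fun a _ => by simp⟩
  | succ k ih =>
    obtain ⟨K, hK, h⟩ := ih
    -- The factors k - i come from pairing the new empty row with the k old ones, and (k + 1)^N from
    -- raising the parameter in the N binomials.
    refine ⟨K * (∏ i : Fin k, ((k : ℝ) - i)) * (k + 1) ^ N, ?_, fun a ha => ?_⟩
    · have : 0 < ∏ i : Fin k, ((k : ℝ) - i) :=
        Finset.prod_pos fun i _ => sub_pos.2 (by exact_mod_cast i.2)
      positivity
    · have e1 : vandermondeProd (fun i : Fin (N + k) =>
          a (Fin.castSucc i) + (N + k + 1 - 1 - (Fin.castSucc i : Fin (N + k + 1)))) =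
          vandermondeProd (fun i : Fin (N + k) => a i + (N + k - 1 - i)) := by
        rw [← vandermondeProd_add_const (fun i : Fin (N + k) => a i + (N + k - 1 - i)) 1]
        congr 1
        funext i
        have := i.2
        simp only [Fin.val_castSucc]
        omega
      have e2 : ∏ i : Fin k, (((a (Fin.castSucc (Fin.natAdd N i)) +
          (N + k + 1 - 1 - (Fin.castSucc (Fin.natAdd N i) : Fin (N + k + 1))) : ℕ) : ℝ) -
          (a (Fin.last (N + k)) + (N + k + 1 - 1 - (Fin.last (N + k) : ℕ)) : ℕ)) =
          ∏ i : Fin k, ((k : ℝ) - i) := by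
        refine Finset.prod_congr rfl fun i _ => ?_
        have := i.2
        simp only [Fin.val_castSucc, Fin.val_natAdd, Fin.val_last]
        rw [ha _ (by omega), ha _ (by omega), show 0 + (N + k + 1 - 1 - (N + i)) = k - i by omega,
          show 0 + (N + k + 1 - 1 - (N + k)) = 0 by omega, Nat.cast_sub this.le]
        simp
      -- The difference between row i and the new empty row is x_i + k + 1, exactly what raises k to
      -- k + 1 in the binomial.
      have e3 : ∀ i : Fin N, (((k + 1 + (a i + (N - 1 - i))).choose (a i + (N - 1 - i)) : ℕ) : ℝ) *
          (k + 1) = ((k + (a i + (N - 1 - i))).choose (a i + (N - 1 - i)) : ℝ) *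
          (((a (Fin.castSucc (Fin.castAdd k i)) +
          (N + k + 1 - 1 - (Fin.castSucc (Fin.castAdd k i) : Fin (N + k + 1))) : ℕ) : ℝ) -
          (a (Fin.last (N + k)) + (N + k + 1 - 1 - (Fin.last (N + k) : ℕ)) : ℕ)) := by
        intro i
        rw [choose_succ_add_mul]
        congr 1
        have := i.2
        simp only [Fin.val_castSucc, Fin.val_castAdd, Fin.val_last]
        rw [ha (N + k) (by omega), show N + k + 1 - 1 - i = (N - 1 - i) + k + 1 by omega,
          show 0 + (N + k + 1 - 1 - (N + k)) = 0 by omega]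
        push_cast
        ring
      have e4 := Finset.prod_congr (rfl : (Finset.univ : Finset (Fin N)) = Finset.univ)
        fun i _ => e3 i
      rw [Finset.prod_mul_distrib, Finset.prod_mul_distrib, Finset.prod_const, Finset.card_univ,
        Fintype.card_fin] at e4
      change vandermondeProd (fun i : Fin (N + k + 1) => a i + (N + k + 1 - 1 - i)) = _
      rw [vandermondeProd_castSucc, e1, h a ha, Fin.prod_univ_add, e2]
      linear_combination -(K * (∏ i : Fin k, ((k : ℝ) - i)) *
        vandermondeProd (fun i : Fin N => a i + (N - 1 - i))) * e4

/-! ### The first row is the last-passage time -/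

/-- The array of weights, indexed from zero. -/
def weightArray (w : ℕ+ × ℕ+ → ℕ) (i j : ℕ) : ℕ := w (i.succPNat, j.succPNat)

section LastPassage

variable (w : ℕ+ × ℕ+ → ℕ)

theorem growth_weightArray_step {p p' : ℕ+ × ℕ+} (h : UpRightStep p p') :
    growth (weightArray w) p.1 p.2 0 + w p' ≤ growth (weightArray w) p'.1 p'.2 0 := by
  obtain ⟨a, b⟩ := p'
  obtain ⟨i, rfl⟩ : ∃ i : ℕ, a = i.succPNat := ⟨a.natPred, by simp⟩
  obtain ⟨j, rfl⟩ : ∃ j : ℕ, b = j.succPNat := ⟨b.natPred, by simp⟩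
  simp only [Nat.succPNat_coe, Nat.succ_eq_add_one]
  rw [growth_succ_succ]
  simp only [growthRule, weightArray]
  rcases h with ⟨h1, h2⟩ | ⟨h1, h2⟩
  · have h1' := congrArg PNat.val h1
    have h2' := congrArg PNat.val h2
    simp only [Nat.succPNat_coe, PNat.add_coe, PNat.one_coe, Nat.succ_eq_add_one] at h1' h2'
    rw [← h2', show (p.1 : ℕ) = i by omega]
    omega
  · have h1' := congrArg PNat.val h1
    have h2' := congrArg PNat.val h2
    simp only [Nat.succPNat_coe, PNat.add_coe, PNat.one_coe, Nat.succ_eq_add_one] at h1' h2'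
    rw [← h1', show (p.2 : ℕ) = j by omega]
    omega

theorem sum_le_growth_weightArray (π : List (ℕ+ × ℕ+)) (hstart : π.head? = some (1, 1))
    (hsteps : π.IsChain UpRightStep) (p : ℕ+ × ℕ+) (hend : π.getLast? = some p) :
    (π.map w).sum ≤ growth (weightArray w) p.1 p.2 0 := by
  induction π using List.reverseRecOn generalizing p with
  | nil => simp at hend
  | append_singleton π p' ih =>
    obtain rfl : p' = p := by simpa using hend
    rcases List.eq_nil_or_concat π with rfl | ⟨π, p, rfl⟩
    · obtain rfl : p' = (1, 1) := by simpa using hstart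
      have : growth (weightArray w) (0 + 1) (0 + 1) 0 = w (1, 1) := by
        rw [growth_succ_succ]
        simp [growthRule, weightArray, Nat.succPNat]
      simpa using this.ge
    · rw [List.concat_eq_append] at *
      have hs := List.isChain_append.1 hsteps
      have h1 := ih (by simpa using hstart) hs.1 p (by simp)
      have h2 := growth_weightArray_step w (hs.2.2 p (by simp) p' (by simp))
      rw [List.map_append, List.sum_append]
      simp only [List.map_cons, List.map_nil, List.sum_singleton]
      omega

theorem IsUpRightPath.snoc {M N M' N' : ℕ+} {π : List (ℕ+ × ℕ+)} (h : IsUpRightPath M N π)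
    (hs : UpRightStep (M, N) (M', N')) : IsUpRightPath M' N' (π ++ [(M', N')]) where
  length_eq := by
    have := h.length_eq
    have := M.pos
    rcases hs with ⟨h1, h2⟩ | ⟨h1, h2⟩ <;> simp only at h1 h2 <;> subst h1 h2 <;>
      simp <;> omega
  start_eq := by
    have := h.start_eq
    cases π <;> simp_all
  end_eq := by simp
  steps := by
    rw [List.isChain_append]
    refine ⟨h.steps, by simp, ?_⟩
    rw [h.end_eq]
    rintro x hx y hy
    obtain rfl : (M, N) = x := by simpa using hx
    obtain rfl : (M', N') = y := by simpa using hy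
    exact hs

/-- A maximizing path is extended from the neighbour that attains the maximum in the first row of
the local rule; next to an axis the other neighbour is 0. -/
theorem exists_path_sum_eq_growth (i j : ℕ) : ∃ π, IsUpRightPath i.succPNat j.succPNat π ∧
    growth (weightArray w) (i + 1) (j + 1) 0 = (π.map w).sum := by
  have up : ∀ i j : ℕ, (∃ π, IsUpRightPath i.succPNat j.succPNat π ∧
      growth (weightArray w) (i + 1) (j + 1) 0 = (π.map w).sum) →
      growth (weightArray w) (i + 2) j 0 ≤ growth (weightArray w) (i + 1) (j + 1) 0 →
      ∃ π, IsUpRightPath (i + 1).succPNat j.succPNat π ∧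
        growth (weightArray w) (i + 2) (j + 1) 0 = (π.map w).sum := by
    rintro i j ⟨π, hπ, hs⟩ h
    refine ⟨_, hπ.snoc (Or.inl ⟨rfl, rfl⟩), ?_⟩
    rw [growth_succ_succ, List.map_append, List.sum_append, ← hs]
    simp only [growthRule, max_eq_left h, weightArray, List.map_cons, List.map_nil,
      List.sum_singleton]
  have right : ∀ i j : ℕ, (∃ π, IsUpRightPath i.succPNat j.succPNat π ∧
      growth (weightArray w) (i + 1) (j + 1) 0 = (π.map w).sum) →
      growth (weightArray w) i (j + 2) 0 ≤ growth (weightArray w) (i + 1) (j + 1) 0 →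
      ∃ π, IsUpRightPath i.succPNat (j + 1).succPNat π ∧
        growth (weightArray w) (i + 1) (j + 2) 0 = (π.map w).sum := by
    rintro i j ⟨π, hπ, hs⟩ h
    refine ⟨_, hπ.snoc (Or.inr ⟨rfl, rfl⟩), ?_⟩
    rw [growth_succ_succ, List.map_append, List.sum_append, ← hs]
    simp only [growthRule, max_eq_right h, weightArray, List.map_cons, List.map_nil,
      List.sum_singleton]
  induction i generalizing j with
  | zero =>
    induction j with
    | zero =>
      refine ⟨[(1, 1)], ⟨rfl, rfl, rfl, by simp⟩, ?_⟩
      rw [growth_succ_succ]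
      simp only [growthRule, growth_zero_left, growth_zero_right, weightArray]
      simp
      rfl
    | succ j ih => exact right 0 j ih (by simp)
  | succ i ih =>
    induction j with
    | zero => exact up i 0 (ih 0) (by simp)
    | succ j ihj =>
      rcases le_total (growth (weightArray w) (i + 2) (j + 1) 0)
        (growth (weightArray w) (i + 1) (j + 2) 0) with h | h
      · exact up i (j + 1) (ih (j + 1)) h
      · exact right (i + 1) j ihj h

/-- The last-passage time is the first row of the partition of the growth diagram. -/
theorem lastPassageTime_eq_growth (M N : ℕ+) :
    lastPassageTime w M N = growth (weightArray w) M N 0 := by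
  have : IsGreatest {s | ∃ π, IsUpRightPath M N π ∧ s = (π.map w).sum}
      (growth (weightArray w) M N 0) := by
    constructor
    · have := exists_path_sum_eq_growth w M.natPred N.natPred
      simpa using this
    · rintro s ⟨π, hπ, rfl⟩
      exact sum_le_growth_weightArray w π hπ.start_eq hπ.steps (M, N) hπ.end_eq
  exact this.csSup_eq

end LastPassage

/-! ### The correspondence and the law of the final partition -/

/-- Extension of a rectangular array by zero. -/
def extendArray {M N : ℕ} (W : Fin M × Fin N → ℕ) (i j : ℕ) : ℕ :=
  if h : i < M ∧ j < N then W (⟨i, h.1⟩, ⟨j, h.2⟩) else 0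

theorem extendArray_val {M N : ℕ} (W : Fin M × Fin N → ℕ) (i : Fin M) (j : Fin N) :
    extendArray W i j = W (i, j) := by
  simp [extendArray]

theorem sum_growth_extendArray {M N : ℕ} (W : Fin M × Fin N → ℕ) :
    ∑ l ∈ Finset.range N, growth (extendArray W) M N l = ∑ p, W p := by
  rw [sum_growth _ M N N le_rfl, Fintype.sum_prod_type, Finset.sum_range]
  refine Finset.sum_congr rfl fun i _ => ?_
  rw [Finset.sum_range]
  exact Finset.sum_congr rfl fun j _ => extendArray_val W i j

/-- The Robinson-Schensted-Knuth correspondence: arrays of weights whose growth diagram ends in a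
given partition correspond to pairs of Gelfand-Tsetlin patterns. -/
theorem bijOn_growth {M N : ℕ} (a : ℕ → ℕ) (hM : ∀ i, M ≤ i → a i = 0)
    (hN : ∀ i, N ≤ i → a i = 0) :
    Set.BijOn (fun W : Fin M × Fin N → ℕ =>
        (fun i => growth (extendArray W) (min i M) N, fun j => growth (extendArray W) M (min j N)))
      {W | growth (extendArray W) M N = a} ↑(gtChains M a ×ˢ gtChains N a) := by
  refine ⟨fun W hW => ?_, fun W hW W' hW' h => ?_, ?_⟩
  · simp only [Finset.coe_product, Set.mem_prod, Finset.mem_coe]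
    rw [mem_gtChains hM, mem_gtChains hN]
    refine ⟨⟨by simp, fun i hi => ?_, fun i hi => by simpa [hi] using hW⟩,
      ⟨by simp, fun i hi => ?_, fun i hi => by simpa [hi] using hW⟩⟩
    · simpa [hi.le, Nat.succ_le_of_lt hi] using (interlace_growth (extendArray W) i N).1
    · simpa [hi.le, Nat.succ_le_of_lt hi] using (interlace_growth (extendArray W) M i).2
  · have h1 := congrArg Prod.fst h
    have h2 := congrArg Prod.snd h
    have key := growth_injective (W := extendArray W) (W' := extendArray W') (m := M) (n := N)
      (fun j hj => by simpa [hj] using congrFun h2 j)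
      (fun i hi => by simpa [hi] using congrFun h1 i)
    funext ⟨i, j⟩
    rw [← extendArray_val W, ← extendArray_val W', key i i.2 j j.2]
  · rintro ⟨p, r⟩ hpr
    simp only [Finset.coe_product, Set.mem_prod, Finset.mem_coe] at hpr
    rw [mem_gtChains hM, mem_gtChains hN] at hpr
    obtain ⟨⟨hp0, hp, hpM⟩, ⟨hr0, hr, hrN⟩⟩ := hpr
    obtain ⟨W, h1, h2⟩ := growth_surjective ((hpM M le_rfl).trans (hrN N le_rfl).symm) hp0 hr0 hp hr
    have hW : ∀ i ≤ M, ∀ j ≤ N,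
        growth (extendArray fun p : Fin M × Fin N => W p.1 p.2) i j = growth W i j :=
      growth_congr fun i hi j hj => by simp [extendArray, hi, hj]
    refine ⟨fun p => W p.1 p.2, ?_, ?_⟩
    · rw [Set.mem_ofPred_eq, hW M le_rfl N le_rfl, h1 M le_rfl, hpM M le_rfl]
    · refine Prod.ext (funext fun i => ?_) (funext fun j => ?_)
      · simp only
        rw [hW _ (min_le_right _ _) N le_rfl, h1 _ (min_le_right _ _)]
        rcases le_total i M with h | h
        · rw [min_eq_left h]
        · rw [min_eq_right h, hpM i h, hpM M le_rfl]
      · simp only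
        rw [hW M le_rfl _ (min_le_right _ _), h2 _ (min_le_right _ _)]
        rcases le_total j N with h | h
        · rw [min_eq_left h]
        · rw [min_eq_right h, hrN j h, hrN N le_rfl]

section Law

variable {M N : ℕ} {q : ℝ}

/-- The law of the final partition for an array of independent geometric weights. -/
theorem measure_growth_eq (ν : Measure (Fin M × Fin N → ℕ))
    (hν : ∀ W, ν {W} = ENNReal.ofReal (∏ p, q ^ W p * (1 - q)))
    (a : ℕ → ℕ) (hM : ∀ i, M ≤ i → a i = 0) (hN : ∀ i, N ≤ i → a i = 0) :
    ν {W | growth (extendArray W) M N = a} = ENNReal.ofReal ((1 - q) ^ (M * N) *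
      q ^ (∑ l ∈ Finset.range N, a l) * ((gtChains M a).card * (gtChains N a).card)) := by
  have hb := bijOn_growth a hM hN
  have hfin : {W : Fin M × Fin N → ℕ | growth (extendArray W) M N = a}.Finite :=
    hb.finite_iff_finite.2 (Finset.finite_toSet _)
  have hcard : hfin.toFinset.card = (gtChains M a).card * (gtChains N a).card := by
    rw [← Finset.card_product, ← Set.ncard_eq_toFinset_card _ hfin, ← Set.ncard_coe_finset,
      ← hb.image_eq, Set.InjOn.ncard_image hb.injOn]
  have hsum : ν {W | growth (extendArray W) M N = a} = ∑ W ∈ hfin.toFinset, ν {W} := by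
    rw [sum_measure_singleton, hfin.coe_toFinset]
  -- The probability depends only on the total weight, which is the size of `a`.
  have hW : ∀ W ∈ hfin.toFinset, ν {W} = ENNReal.ofReal ((1 - q) ^ (M * N) *
      q ^ (∑ l ∈ Finset.range N, a l)) := by
    intro W hW
    rw [hfin.mem_toFinset, Set.mem_ofPred_eq] at hW
    rw [hν, ← hW, sum_growth_extendArray, Finset.prod_mul_distrib, Finset.prod_pow_eq_pow_sum]
    simp [mul_comm]
  rw [hsum, Finset.sum_congr rfl hW, Finset.sum_const, hcard, nsmul_eq_mul, mul_comm,
    ← Nat.cast_mul, ENNReal.ofReal_mul' (Nat.cast_nonneg _), ENNReal.ofReal_natCast]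

theorem StrictAnti.sub_le_apply {x : Fin N → ℕ} (hx : StrictAnti x) (i : Fin N) :
    N - 1 - i ≤ x i := by
  have : ∀ k : ℕ, ∀ i : Fin N, N - 1 - i = k → k ≤ x i := by
    intro k
    induction k with
    | zero => exact fun _ _ => Nat.zero_le _
    | succ k ih =>
      intro i hi
      have h1 := ih ⟨i + 1, by omega⟩ (by simp only; omega)
      have h2 := hx (show i < ⟨i + 1, by omega⟩ from Fin.lt_def.2 (by simp))
      omega
  exact this _ i rfl

/-- The particle configuration of an array of weights: the shifted rows of the final partition. -/
def particles (W : Fin M × Fin N → ℕ) (i : Fin N) : ℕ :=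
  growth (extendArray W) M N i + (N - 1 - i)

theorem strictAnti_particles (hMN : N ≤ M) (W : Fin M × Fin N → ℕ) : StrictAnti (particles W) := by
  have hanti : ∀ i, growth (extendArray W) M N (i + 1) ≤ growth (extendArray W) M N i := by
    intro i
    rcases Nat.eq_zero_or_pos M with rfl | hM
    · simp
    · obtain ⟨m, rfl⟩ : ∃ m, M = m + 1 := ⟨M - 1, by omega⟩
      have := (interlace_growth (extendArray W) m N).1 i
      omega
  intro i j hij
  have h := antitone_nat_of_succ_le hanti (Fin.le_def.1 hij.le)
  have hj := j.2
  have := Fin.lt_def.1 hij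
  simp only [particles]
  omega

theorem particles_eq_iff {x : Fin N → ℕ} (hx : StrictAnti x) (W : Fin M × Fin N → ℕ) :
    particles W = x ↔
      growth (extendArray W) M N = zeroExtend fun i : Fin N => x i - (N - 1 - i) := by
  constructor
  · rintro rfl
    funext l
    by_cases hl : l < N
    · simp [zeroExtend, hl, particles]
    · rw [zeroExtend_of_le _ (not_lt.1 hl), growth_eq_zero_of_le _ _ _ _ (Or.inr (not_lt.1 hl))]
  · intro h
    funext i
    have := hx.sub_le_apply i
    rw [particles, h, zeroExtend_val]
    omega

/-- Each of the two chain counts gives one Vandermonde factor, and the longer one also the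
binomials. Only proportionality matters, so `C` is left unspecified. -/
theorem exists_measure_particles_eq (hMN : N ≤ M) (hq0 : 0 < q) (hq1 : q < 1)
    (ν : Measure (Fin M × Fin N → ℕ))
    (hν : ∀ W, ν {W} = ENNReal.ofReal (∏ p, q ^ W p * (1 - q))) :
    ∃ C : ℝ, 0 < C ∧ ∀ x : Fin N → ℕ, StrictAnti x →
      ν {W | particles W = x} = ENNReal.ofReal (C * opeWeight N (meixnerWeight M N q) x) := by
  obtain ⟨k, rfl⟩ := Nat.exists_eq_add_of_le hMN
  obtain ⟨K, hK, hV⟩ := exists_vandermondeProd_add_eq N k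
  have hfac : ∀ n, 0 < ∏ i : Fin n, ((i : ℕ).factorial : ℝ) := fun n =>
    Finset.prod_pos fun i _ => by exact_mod_cast Nat.factorial_pos _
  have h1 := hfac (N + k)
  have h2 := hfac N
  have h3 : 0 < 1 - q := by linarith
  -- `K` comes from the empty rows, the factorials from the two dimension formulas, and the power of
  -- `q` from the shift between rows and particles.
  refine ⟨(1 - q) ^ ((N + k) * N) * K / ((∏ i : Fin (N + k), ((i : ℕ).factorial : ℝ)) *
    (∏ i : Fin N, ((i : ℕ).factorial : ℝ)) * q ^ ∑ i : Fin N, (N - 1 - i)), by positivity,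
    fun x hx => ?_⟩
  set a := zeroExtend fun i : Fin N => x i - (N - 1 - i) with ha
  have haz : ∀ i, N ≤ i → a i = 0 := fun i hi => zeroExtend_of_le _ hi
  have hax : ∀ i : Fin N, a i + (N - 1 - i) = x i := fun i => by
    rw [ha, zeroExtend_val]
    exact Nat.sub_add_cancel (hx.sub_le_apply i)
  have hanti : ∀ i, a (i + 1) ≤ a i := by
    intro i
    by_cases hi : i + 1 < N
    · have h4 := hax ⟨i, by omega⟩
      have h5 := hax ⟨i + 1, hi⟩
      have h6 := hx (show (⟨i, by omega⟩ : Fin N) < ⟨i + 1, hi⟩ from Fin.lt_def.2 (by simp))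
      simp only at h4 h5
      omega
    · rw [haz _ (not_lt.1 hi)]
      exact Nat.zero_le _
  have hset : {W : Fin (N + k) × Fin N → ℕ | particles W = x} =
      {W | growth (extendArray W) (N + k) N = a} := by
    ext W
    exact particles_eq_iff hx W
  rw [hset, measure_growth_eq ν hν a (fun i hi => haz i (by omega)) haz]
  congr 1
  have e1 := card_gtChains_mul_prod_factorial (N + k) a fun i _ => hanti i
  have e2 := card_gtChains_mul_prod_factorial N a fun i _ => hanti i
  rw [hV a haz] at e1
  simp only [hax] at e1 e2
  have e3 : q ^ (∑ l ∈ Finset.range N, a l) * q ^ (∑ i : Fin N, (N - 1 - i)) =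
      ∏ i, q ^ x i := by
    rw [← pow_add, Finset.sum_range, ← Finset.sum_add_distrib, Finset.prod_pow_eq_pow_sum]
    simp only [hax]
  simp only [opeWeight, meixnerWeight, Nat.add_sub_cancel_left, Finset.prod_mul_distrib]
  rw [← e3, div_mul_eq_mul_div, eq_div_iff (by positivity)]
  linear_combination (1 - q) ^ ((N + k) * N) * q ^ (∑ l ∈ Finset.range N, a l) *
    q ^ (∑ i : Fin N, (N - 1 - i)) *
    ((gtChains N a).card * (∏ i : Fin N, ((i : ℕ).factorial : ℝ)) * e1 +
      K * (vandermondeProd x * ∏ i, ((k + x i).choose (x i) : ℝ)) * e2)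

end Law

/-! ### From ordered to unordered configurations -/

section Symmetrization

-- An injective tuple has exactly one strictly decreasing rearrangement, so summing over
-- permutations counts each ordered configuration N! times.
open scoped Classical in
theorem tsum_eq_factorial_mul_tsum_strictAnti {N : ℕ} (f : (Fin N → ℕ) → ENNReal)
    (hsymm : ∀ x (σ : Equiv.Perm (Fin N)), f (x ∘ σ) = f x)
    (hinj : ∀ x, ¬ Function.Injective x → f x = 0) :
    ∑' x, f x = N.factorial * ∑' x, if StrictAnti x then f x else 0 := by
  have key : ∀ x, f x = ∑ σ : Equiv.Perm (Fin N), if StrictAnti (x ∘ σ) then f (x ∘ σ) else 0 := by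
    intro x
    by_cases hx : Function.Injective x
    · have hanti : StrictAnti (x ∘ (Fin.revPerm.trans (Tuple.sort x))) := by
        have h : StrictMono (x ∘ Tuple.sort x) :=
          (Tuple.monotone_sort x).strictMono_of_injective (hx.comp (Tuple.sort x).injective)
        exact fun i j hij => h (Fin.rev_lt_rev.2 hij)
      rw [Finset.sum_eq_single (Fin.revPerm.trans (Tuple.sort x)), if_pos hanti, hsymm]
      · intro τ _ hτ
        refine if_neg fun h => hτ ?_
        -- Two strictly decreasing tuples with the same range coincide.
        have : x ∘ τ = x ∘ (Fin.revPerm.trans (Tuple.sort x)) := by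
          rw [← h.range_inj hanti]
          simp only [Set.range_comp, Equiv.range_eq_univ]
        exact Equiv.ext fun i => hx (congrFun this i)
      · simp
    · rw [hinj x hx, Finset.sum_eq_zero]
      intro σ _
      rw [hsymm, hinj x hx, ite_self]
  calc ∑' x, f x = ∑' x, ∑ σ : Equiv.Perm (Fin N),
        if StrictAnti (x ∘ σ) then f (x ∘ σ) else 0 := tsum_congr key
    _ = ∑ σ : Equiv.Perm (Fin N), ∑' x : Fin N → ℕ,
        if StrictAnti (x ∘ σ) then f (x ∘ σ) else 0 :=
      Summable.tsum_finsetSum fun _ _ => ENNReal.summable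
    _ = ∑ σ : Equiv.Perm (Fin N), ∑' x : Fin N → ℕ, if StrictAnti x then f x else 0 := by
      refine Finset.sum_congr rfl fun σ _ => ?_
      exact (Equiv.arrowCongr σ.symm (Equiv.refl ℕ)).tsum_eq
        fun x : Fin N → ℕ => if StrictAnti x then f x else 0
    _ = _ := by
      rw [Finset.sum_const, Finset.card_univ, Fintype.card_perm, Fintype.card_fin, nsmul_eq_mul]

theorem vandermondeProd_comp_perm_sq {N : ℕ} (x : Fin N → ℕ) (σ : Equiv.Perm (Fin N)) :
    vandermondeProd (x ∘ σ) ^ 2 = vandermondeProd x ^ 2 := by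
  have : Matrix.vandermonde (fun i => (((x ∘ σ) i : ℕ) : ℝ)) =
      (Matrix.vandermonde fun i => (x i : ℝ)).submatrix σ id := rfl
  rw [vandermondeProd_eq_det, vandermondeProd_eq_det, this, Matrix.det_permute, mul_pow, mul_pow,
    mul_pow, ← Int.cast_pow, ← Units.val_pow_eq_pow_val, Int.units_sq]
  simp

theorem vandermondeProd_eq_zero {N : ℕ} {x : Fin N → ℕ} (hx : ¬ Function.Injective x) :
    vandermondeProd x = 0 := by
  rw [vandermondeProd_eq_det, mul_eq_zero]
  right
  by_contra h
  exact hx fun i j hij => Matrix.det_vandermonde_ne_zero_iff.1 h (by simp [hij])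

variable {N : ℕ} (v : ℕ → ℝ)

theorem opeWeight_comp_perm (x : Fin N → ℕ) (σ : Equiv.Perm (Fin N)) :
    opeWeight N v (x ∘ σ) = opeWeight N v x := by
  rw [opeWeight, opeWeight, vandermondeProd_comp_perm_sq]
  congr 1
  exact Equiv.prod_comp σ fun i => v (x i)

theorem opeWeight_eq_zero {x : Fin N → ℕ} (hx : ¬ Function.Injective x) :
    opeWeight N v x = 0 := by
  simp [opeWeight, vandermondeProd_eq_zero hx]

variable {v}

theorem opeWeight_nonneg (hv : ∀ k, 0 ≤ v k) (x : Fin N → ℕ) : 0 ≤ opeWeight N v x :=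
  mul_nonneg (sq_nonneg _) (Finset.prod_nonneg fun _ _ => hv _)

/-- A probability measure on ordered configurations proportional to the weight of an orthogonal
polynomial ensemble agrees with the ensemble on permutation-invariant sets. -/
theorem opEnsemble_eq_of_strictAnti (hv : ∀ k, 0 ≤ v k) (η : Measure (Fin N → ℕ))
    [IsProbabilityMeasure η] (C : ℝ) (hC : 0 < C)
    (hη : ∀ x, StrictAnti x → η {x} = ENNReal.ofReal (C * opeWeight N v x))
    (hη0 : ∀ x, ¬ StrictAnti x → η {x} = 0) (A : Set (Fin N → ℕ))
    (hA : ∀ x (σ : Equiv.Perm (Fin N)), x ∘ σ ∈ A ↔ x ∈ A) :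
    opEnsemble N v A = η A := by
  classical
  set f : (Fin N → ℕ) → ENNReal := fun x => ENNReal.ofReal (opeWeight N v x) with hf
  set c := ENNReal.ofReal C with hc
  have hc0 : c ≠ 0 := by simpa [hc] using hC
  have hct : c ≠ ⊤ := ENNReal.ofReal_ne_top
  have hmain : ∀ B : Set (Fin N → ℕ), (∀ x (σ : Equiv.Perm (Fin N)), x ∘ σ ∈ B ↔ x ∈ B) →
      N.factorial * η B = c * ∑' x, B.indicator f x := by
    intro B hB
    rw [tsum_eq_factorial_mul_tsum_strictAnti, mul_left_comm, ← ENNReal.tsum_mul_left,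
      ← Measure.tsum_indicator_apply_singleton η B (Set.to_countable B).measurableSet]
    · congr 2
      funext x
      by_cases hx : x ∈ B <;> by_cases hxa : StrictAnti x
      · simp [hx, hxa, hη, hf, hc, ENNReal.ofReal_mul hC.le]
      · simp [hx, hxa, hη0]
      · simp [hx]
      · simp [hx]
    · intro x σ
      simp only [Set.indicator_apply, hB, hf, opeWeight_comp_perm]
    · intro x hx
      simp [Set.indicator_apply, hf, opeWeight_eq_zero v hx]
  -- Taking the whole space fixes the constant: C Z_N = N!. In particular the total weight is
  -- neither zero nor infinite.
  have htot : (N.factorial : ENNReal) = c * ∑' x, f x := by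
    simpa using hmain Set.univ (by simp)
  have hN0 : (N.factorial : ENNReal) ≠ 0 := by exact_mod_cast N.factorial_ne_zero
  have hZ0 : ∑' x, f x ≠ 0 := fun h => hN0 (by rw [htot, h, mul_zero])
  have hZt : ∑' x, f x ≠ ⊤ := fun h => ENNReal.natCast_ne_top N.factorial (by
    rw [htot, h, ENNReal.mul_top hc0])
  -- Finiteness of the extended sum makes the real `tsum` a true normalization and not a default
  -- value.
  have hZ : opePartition N v = (∑' x, f x).toReal := by
    rw [ENNReal.tsum_toReal_eq fun x => ENNReal.ofReal_ne_top, opePartition]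
    exact tsum_congr fun x => (ENNReal.toReal_ofReal (opeWeight_nonneg hv x)).symm
  have hZpos : 0 < opePartition N v := hZ ▸ ENNReal.toReal_pos hZ0 hZt
  have hens : opEnsemble N v A = (∑' x, A.indicator f x) / ∑' x, f x := by
    rw [opEnsemble, withDensity_apply _ (Set.to_countable A).measurableSet,
      ← lintegral_indicator (Set.to_countable A).measurableSet, lintegral_count, div_eq_mul_inv,
      ← ENNReal.tsum_mul_right]
    refine tsum_congr fun x => ?_
    by_cases hx : x ∈ A
    · rw [Set.indicator_of_mem hx, Set.indicator_of_mem hx, ENNReal.ofReal_div_of_pos hZpos, hZ,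
        ENNReal.ofReal_toReal hZt, div_eq_mul_inv]
    · simp [hx]
  rw [hens, eq_comm, ENNReal.eq_div_iff hZ0 hZt, ← ENNReal.mul_right_inj hc0 hct, ← hmain A hA,
    htot, mul_assoc]

end Symmetrization

/-! ### Conclusion -/

theorem largestParticle_eq_of_strictAnti {N : ℕ} (hN : 0 < N) {x : Fin N → ℕ}
    (hx : StrictAnti x) : largestParticle x = x ⟨0, hN⟩ :=
  le_antisymm (Finset.sup_le fun i _ => hx.antitone (Fin.le_def.2 (Nat.zero_le i)))
    (Finset.le_sup (Finset.mem_univ (⟨0, hN⟩ : Fin N)))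

theorem largestParticle_comp_perm {N : ℕ} (x : Fin N → ℕ) (σ : Equiv.Perm (Fin N)) :
    largestParticle (x ∘ σ) = largestParticle x := by
  simpa [largestParticle] using (Finset.sup_map Finset.univ σ.toEmbedding x).symm

theorem meixnerWeight_nonneg (M N : ℕ) {q : ℝ} (hq : 0 ≤ q) (k : ℕ) : 0 ≤ meixnerWeight M N q k :=
  mul_nonneg (Nat.cast_nonneg _) (pow_nonneg hq k)

theorem lastPassageTime_add_eq_largestParticle (w : ℕ+ × ℕ+ → ℕ) {M N : ℕ+} (hMN : N ≤ M) :
    lastPassageTime w M N + ((N : ℕ) - 1) =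
      largestParticle (particles fun p : Fin M × Fin N => weightArray w p.1 p.2) := by
  set W : Fin M × Fin N → ℕ := fun p => weightArray w p.1 p.2 with hW
  have h1 : growth (weightArray w) M N = growth (extendArray W) M N :=
    growth_congr (fun i hi j hj => by simp [extendArray, hi, hj, hW]) _ le_rfl _ le_rfl
  rw [largestParticle_eq_of_strictAnti N.pos (strictAnti_particles (M := M) (N := N) hMN W),
     lastPassageTime_eq_growth, h1]
  rfl

theorem geometricMeasure_map_array {Ω : Type*} [MeasurableSpace Ω] (μ : Measure Ω)
    (M N : ℕ) (q : ℝ) (hq0 : 0 < q) (hq1 : q < 1) (w : ℕ+ × ℕ+ → Ω → ℕ) (hindep : iIndepFun w μ)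
    (hlaw : ∀ p, HasLaw (w p) (geometricMeasure ⟨1 - q, by linarith, by linarith⟩) μ)
    (W : Fin M × Fin N → ℕ) :
    μ.map (fun ω (p : Fin M × Fin N) => weightArray (fun s => w s ω) p.1 p.2) {W} =
      ENNReal.ofReal (∏ p, q ^ W p * (1 - q)) := by
  let e : Fin M × Fin N → ℕ+ × ℕ+ := fun p => ((p.1 : ℕ).succPNat, (p.2 : ℕ).succPNat)
  have he : Function.Injective e := by
    rintro ⟨i, j⟩ ⟨i', j'⟩ h
    obtain ⟨h1, h2⟩ := Prod.mk.inj h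
    exact Prod.ext (Fin.ext (Nat.succPNat_injective h1)) (Fin.ext (Nat.succPNat_injective h2))
  have hmeas : AEMeasurable
      (fun ω (p : Fin M × Fin N) => weightArray (fun s => w s ω) p.1 p.2) μ :=
    aemeasurable_pi_lambda _ fun p => (hlaw (e p)).aemeasurable
  have hset : (fun ω (p : Fin M × Fin N) => weightArray (fun s => w s ω) p.1 p.2) ⁻¹' {W} =
      ⋂ p ∈ (Finset.univ : Finset (Fin M × Fin N)), w (e p) ⁻¹' {W p} := by
    ext ω
    simp [funext_iff, weightArray, e]
  rw [Measure.map_apply_of_aemeasurable hmeas (measurableSet_singleton W), hset,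
    (hindep.precomp he).measure_inter_preimage_eq_mul Finset.univ fun _ _ =>
      measurableSet_singleton _,
    ENNReal.ofReal_prod_of_nonneg fun p _ => by
      have : 0 ≤ 1 - q := by linarith
      positivity]
  refine Finset.prod_congr rfl fun p _ => ?_
  rw [← Measure.map_apply_of_aemeasurable (hlaw (e p)).aemeasurable (measurableSet_singleton _),
    (hlaw (e p)).map_eq, geometricMeasure_singleton]
  · simp
  · intro h
    have := congrArg Subtype.val h
    simp only [Set.Icc.coe_zero] at this
    linarith

theorem theorem3p1 {Ω : Type*} [MeasurableSpace Ω] (μ : Measure Ω) [IsProbabilityMeasure μ]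
    (M N : ℕ+) (hMN : N ≤ M) (q : ℝ) (hq0 : 0 < q) (hq1 : q < 1)
    (w : ℕ+ × ℕ+ → Ω → ℕ)
    (hindep : iIndepFun w μ)
    (hlaw : ∀ p, HasLaw (w p) (geometricMeasure ⟨1 - q, by linarith, by linarith⟩) μ) :
    IsProbabilityMeasure (meixnerEnsemble M N q) ∧
      IdentDistrib (fun ω => lastPassageTime (fun p => w p ω) M N + ((N : ℕ) - 1))
        largestParticle μ (meixnerEnsemble M N q) := by
  have hMN' : (N : ℕ) ≤ M := hMN
  set V : Ω → Fin M × Fin N → ℕ := fun ω p => weightArray (fun s => w s ω) p.1 p.2 with hV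
  have hVmeas : AEMeasurable V μ := aemeasurable_pi_lambda _ fun p => (hlaw _).aemeasurable
  have hpart : Measurable (particles (M := M) (N := N)) := measurable_of_countable _
  have hXmeas : AEMeasurable (fun ω => particles (V ω)) μ := hpart.comp_aemeasurable hVmeas
  have hmap : μ.map (fun ω => particles (V ω)) = (μ.map V).map particles :=
    (AEMeasurable.map_map_of_aemeasurable hpart.aemeasurable hVmeas).symm
  obtain ⟨C, hC, hlawX⟩ := exists_measure_particles_eq hMN' hq0 hq1 (μ.map V)
    (geometricMeasure_map_array μ M N q hq0 hq1 w hindep hlaw)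
  have hprob : IsProbabilityMeasure (μ.map fun ω => particles (V ω)) :=
    Measure.isProbabilityMeasure_map hXmeas
  -- This is used for the whole space, giving total mass one, and for the level sets of
  -- `largestParticle`.
  have hens : ∀ A : Set (Fin N → ℕ), (∀ x (σ : Equiv.Perm (Fin N)), x ∘ σ ∈ A ↔ x ∈ A) →
      meixnerEnsemble M N q A = μ.map (fun ω => particles (V ω)) A := by
    refine opEnsemble_eq_of_strictAnti (meixnerWeight_nonneg M N hq0.le) _ C hC
      (fun x hx => ?_) (fun x hx => ?_)
    · rw [hmap, Measure.map_apply hpart (measurableSet_singleton x), ← hlawX x hx]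
      rfl
    · rw [hmap, Measure.map_apply hpart (measurableSet_singleton x)]
      -- The particles of an array are always strictly decreasing, so no array maps to `x`.
      convert measure_empty (μ := μ.map V)
      ext W
      simp only [Set.mem_preimage, Set.mem_singleton_iff, Set.mem_empty_iff_false, iff_false]
      rintro rfl
      exact hx (strictAnti_particles hMN' W)
  have hlarge : Measurable (largestParticle (N := N)) := measurable_of_countable _
  have hG : (fun ω => lastPassageTime (fun p => w p ω) M N + ((N : ℕ) - 1)) =
      fun ω => largestParticle (particles (V ω)) :=
    funext fun ω => lastPassageTime_add_eq_largestParticle _ hMN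
  refine ⟨⟨by rw [hens Set.univ (by simp), measure_univ]⟩, ?_⟩
  rw [hG]
  refine ⟨hlarge.comp_aemeasurable hXmeas, hlarge.aemeasurable, ?_⟩
  refine Measure.ext_of_singleton fun k => ?_
  rw [← Function.comp_def largestParticle,
    ← AEMeasurable.map_map_of_aemeasurable hlarge.aemeasurable hXmeas,
    Measure.map_apply hlarge (measurableSet_singleton k),
    Measure.map_apply hlarge (measurableSet_singleton k), hens]
  intro x σ
  simp [largestParticle_comp_perm]
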